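/- For $n\ge 1$ let $\Omega_n=\{0,1,-1,\dots,n,-n\}$, and let $\mathfrak{B}_n$ be the group of signed permutations, i.e. bijections $\pi:\Omega_n\to\Omega_n$ with $\pi(-a)=-\pi(a)$ for all $a\in\Omega_n$ (so $\pi(0)=0$); write $\pi_i=\pi(i)$. Let $<_r$ be the total order on $\mathbb{Z}$ given by $$-1<_r-2<_r-3<_r\cdots<_r0<_r1<_r2<_r\cdots$$ and let $\operatorname{des}_B(\pi)=\#\{i\in\{0,1,\dots,n-1\} : \pi_i>_r\pi_{i+1}\}$. A fixed-point free signed involution is a $\pi\in\mathfrak{B}_n$ with $\pi^{-1}=\pi$ and $\pi(i)\ne i$, $\pi(i)\ne -i$ for every $i\in\{1,\dots,n\}$. For $k\in\mathbb{Z}$ let $J^{\underline{B}}_{n,k}$ be the number of fixed-point free signed involutions $\pi\in\mathfrak{B}_n$ with $\operatorname{des}_B(\pi)=k$. **Theorem.** For all integers $n\ge 2$ and $k\ge 0$, $$\begin{aligned} n J^{\underline{B}}_{2n,k}={}&(k^2+n-1)\,J^{\underline{B}}_{2n-2,k}+\bigl(2(k-1)(2n-k)+1\bigr)J^{\underline{B}}_{2n-2,k-1}\\&+\bigl((k-2)(k-4n)+4n^2-3n\bigr)J^{\underline{B}}_{2n-2,k-2},\end{aligned}$$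 and $J^{\underline{B}}_{2,0}=0$, $J^{\underline{B}}_{2,1}=1$, $J^{\underline{B}}_{2,2}=1$, and $J^{\underline{B}}_{2n,k}=0$ for all $n\ge 1$ and $k<0$. -/

import Mathlib

/-!
Let `π` be a signed permutation of length `N` and let `0 = F 0 ≤ ⋯ ≤ F N ≤ m` be a chain that is
strict at the descents of `π`. Give the letter `π i` the colour `2 * F i - [π i < 0]` in
`{0, …, 2 * m}`. By the definition of the `r`-order, being strict at the descents means exactly
that colours weakly increase and that absolute values of letters increase on each colour class.
If `π` is a fixed-point free involution, then two positions exchanged by `|π|` have letters of the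
same sign, hence colours of the same parity, and distinct colours because a decreasing pair cannot
lie in one class. Conversely, a multiset of `n` edges joining distinct colours of the same parity
determines the weakly increasing sequence of its `2 * n` colours, and sorting each colour class by
the other ends of the edges determines which positions are exchanged. The graph of these edges has
`m ^ 2` edges, while `π` with `d` descents admits `multichoose (m + 1 - d) N` chains, so that

  `∑ k, J (2 * n) k * X ^ k = (1 - X) ^ (2 * n + 1) * ∑ m, multichoose (m ^ 2) n * X ^ m`.

Finally `(n + 1) * multichoose q (n + 1) = (q + n) * multichoose q n` for `q = m ^ 2` says that the
operator `θ ^ 2 + n` with `θ = X * d / dX` takes the sum on the right for `n` to `n + 1` times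
the one for `n + 1`, and comparing coefficients gives the recurrence.
-/

namespace SignedInvolution

/-- The set `Ω_n = {0, 1, -1, …, n, -n}`. -/
abbrev Omega (n : ℕ) : Type := {a : ℤ // -(n : ℤ) ≤ a ∧ a ≤ n}

/-- The map `a ↦ -a` on `Ω_n`. -/
def Omega.opp {n : ℕ} (a : Omega n) : Omega n :=
  ⟨-a.1, by have h := a.2; omega⟩

/-- The element `i` of `Ω_n`, for `0 ≤ i ≤ n`. -/
def Omega.ofIndex {n : ℕ} (i : Fin (n + 1)) : Omega n :=
  ⟨(i : ℤ), by have h := i.2; omega⟩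

/-- The hyperoctahedral group `𝔅_n`: the bijections `π` of `Ω_n` with `π(-a) = -π(a)`. -/
def hyperoctahedral (n : ℕ) : Subgroup (Equiv.Perm (Omega n)) where
  carrier := {π | ∀ a, π a.opp = (π a).opp}
  mul_mem' := by
    intro σ τ hσ hτ a
    rw [Equiv.Perm.mul_apply, Equiv.Perm.mul_apply, hτ a, hσ (τ a)]
  one_mem' := fun _ => rfl
  inv_mem' := by
    intro σ hσ a
    apply σ.injective
    rw [hσ (σ⁻¹ a)]
    simp

/-- The strict `r`-order on `ℤ`: `-1 <_r -2 <_r ⋯ <_r 0 <_r 1 <_r 2 <_r ⋯`. -/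
def rLT (a b : ℤ) : Prop :=
  (a < 0 ∧ 0 ≤ b) ∨ (a < 0 ∧ b < 0 ∧ b < a) ∨ (0 ≤ a ∧ 0 ≤ b ∧ a < b)

instance (a b : ℤ) : Decidable (rLT a b) := by unfold rLT; infer_instance

/-- The letter `π_i = π(i)`, for `0 ≤ i ≤ n`. -/
def letter {n : ℕ} (π : hyperoctahedral n) (i : Fin (n + 1)) : ℤ :=
  (π.1 (Omega.ofIndex i)).1

/-- The set of indices `i ∈ {0, …, n - 1}` with `π_i >_r π_{i+1}`. -/
def rDescents {n : ℕ} (π : hyperoctahedral n) : Finset (Fin n) :=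
  Finset.univ.filter fun i => rLT (letter π i.succ) (letter π i.castSucc)

/-- The number of descents of `π` under the `r`-order. -/
def rDes {n : ℕ} (π : hyperoctahedral n) : ℕ := (rDescents π).card

/-- `π` is a fixed-point free signed involution: `π⁻¹ = π`, and `π(i) ≠ i`, `π(i) ≠ -i` for all
`1 ≤ i ≤ n`. -/
def IsFixedPointFreeInvolution {n : ℕ} (π : hyperoctahedral n) : Prop :=
  π⁻¹ = π ∧
    ∀ i : Fin (n + 1), 1 ≤ (i : ℕ) → letter π i ≠ (i : ℤ) ∧ letter π i ≠ -(i : ℤ)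

/-- The number `J_{n,k}` of fixed-point free signed involutions in `𝔅_n` with exactly `k` descents
under the `r`-order; the index `k` is any integer. -/
noncomputable def J (n : ℕ) (k : ℤ) : ℕ :=
  Set.ncard {π : hyperoctahedral n | IsFixedPointFreeInvolution π ∧ (rDes π : ℤ) = k}

end SignedInvolution

namespace SignedInvolution

open Finset Function

section Words

variable {α β : Type*} {N : ℕ}

/-- The multiset of letters of the word `f 0, …, f (N - 1)`. -/
def content (f : Fin N → α) : Sym α N := ⟨univ.val.map f, by simp⟩

theorem content_comp_perm (f : Fin N → α) (σ : Equiv.Perm (Fin N)) :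
    content (f ∘ σ) = content f := by
  refine Subtype.ext ?_
  change univ.val.map (f ∘ σ) = univ.val.map f
  conv_rhs => rw [← map_univ_equiv σ, map_val, Multiset.map_map]
  rfl

theorem map_content (s : α → β) (f : Fin N → α) : (content f).map s = content (s ∘ f) :=
  Subtype.ext (Multiset.map_map s f univ.val)

theorem eq_of_monotone_of_content_eq [PartialOrder α] {f g : Fin N → α} (hf : Monotone f)
    (hg : Monotone g) (h : content f = content g) : f = g := by
  have h' : univ.val.map f = univ.val.map g := congrArg Subtype.val h
  rw [Fin.univ_val_map, Fin.univ_val_map, Multiset.coe_eq_coe] at h'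
  exact List.ofFn_injective (h'.eq_of_sortedLE hf.sortedLE_ofFn hg.sortedLE_ofFn)

theorem exists_monotone_content_eq [LinearOrder α] (M : Sym α N) :
    ∃ f : Fin N → α, Monotone f ∧ content f = M := by
  obtain ⟨⟨M⟩, h⟩ := M
  obtain rfl : M.length = N := h
  refine ⟨M.get ∘ Tuple.sort M.get, Tuple.monotone_sort _, ?_⟩
  rw [content_comp_perm]
  exact Subtype.ext ((Fin.univ_val_map _).trans (congrArg _ (List.ofFn_get M)))

/-- Weakly increasing words are determined by their content, which is arbitrary. -/
noncomputable def monotoneEquivSym (α : Type*) [LinearOrder α] (N : ℕ) :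
    {f : Fin N → α // Monotone f} ≃ Sym α N :=
  Equiv.ofBijective (fun f => content f.1)
    ⟨fun f g h => Subtype.ext (eq_of_monotone_of_content_eq f.2 g.2 h), fun M =>
      let ⟨f, hf, h⟩ := exists_monotone_content_eq M
      ⟨⟨f, hf⟩, h⟩⟩

end Words

section MatedWords

variable {β : Type*} {N n : ℕ} {s : β → β} {w : Fin N → β} {σ : Equiv.Perm (Fin N)}

/-- The permutation `σ` of the positions of the word `w` realizes the map `s` on its letters, in an
order-preserving way on each set of positions carrying the same letter. -/
structure IsMate (s : β → β) (w : Fin N → β) (σ : Equiv.Perm (Fin N)) : Prop where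
  apply_mate : ∀ i, w (σ i) = s (w i)
  lt_of_eq : ∀ ⦃i j⦄, i < j → w i = w j → σ i < σ j

theorem IsMate.content_comp (h : IsMate s w σ) : content (s ∘ w) = content w := by
  rw [← content_comp_perm w σ]
  exact congrArg content (funext fun i => (h.apply_mate i).symm)

theorem IsMate.symm (hs : Involutive s) (h : IsMate s w σ) : IsMate s w σ.symm := by
  have apply_symm (i) : w (σ.symm i) = s (w i) := by
    rw [← hs.eq_iff, ← h.apply_mate, σ.apply_symm_apply]
  refine ⟨apply_symm, fun i j hij hw => lt_of_not_ge fun hle => ?_⟩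
  rcases hle.lt_or_eq with hlt | heq
  · have := h.lt_of_eq hlt (by rw [apply_symm, apply_symm, hw])
    exact this.not_gt (by rwa [σ.apply_symm_apply, σ.apply_symm_apply])
  · exact hij.ne' (σ.symm.injective heq)

variable [LinearOrder β]

theorem IsMate.eq_sort (hs : Involutive s) (hw : Monotone w) (h : IsMate s w σ) :
    σ = Tuple.sort (s ∘ w) := by
  have apply_comp (i) : s (w (σ i)) = w i := by rw [h.apply_mate, hs]
  refine Tuple.eq_sort_iff.2 ⟨?_, fun i j hij he => h.lt_of_eq hij ?_⟩
  · rwa [show (s ∘ w) ∘ σ = w from funext apply_comp]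
  · simpa only [comp_apply, apply_comp] using he

theorem IsMate.involutive (hs : Involutive s) (hw : Monotone w) (h : IsMate s w σ) :
    Involutive σ := fun i => by
  have symm_eq : σ.symm = σ := ((h.symm hs).eq_sort hs hw).trans (h.eq_sort hs hw).symm
  nth_rewrite 1 [← symm_eq]
  exact σ.symm_apply_apply i

theorem isMate_sort (hs : Involutive s) (hw : Monotone w) (h : content (s ∘ w) = content w) :
    IsMate s w (Tuple.sort (s ∘ w)) := by
  obtain ⟨hmono, hlt⟩ := Tuple.eq_sort_iff.1 (rfl : Tuple.sort (s ∘ w) = _)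
  have comp_sort : (s ∘ w) ∘ Tuple.sort (s ∘ w) = w :=
    eq_of_monotone_of_content_eq hmono hw ((content_comp_perm _ _).trans h)
  refine ⟨fun i => ?_, fun i j hij he => hlt i j hij ?_⟩
  · rw [← hs (w (Tuple.sort _ i))]
    exact congrArg s (congrFun comp_sort i)
  · exact (congrFun comp_sort i).trans (he.trans (congrFun comp_sort j).symm)

/-- A weakly increasing word with a mate is determined by its content, which is an arbitrary
`s`-invariant multiset. -/
noncomputable def matedWordEquiv (N : ℕ) (hs : Involutive s) :
    {p : (Fin N → β) × Equiv.Perm (Fin N) // Monotone p.1 ∧ IsMate s p.1 p.2} ≃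
      {M : Sym β N // M.map s = M} :=
  Equiv.ofBijective
    (fun p => ⟨content p.1.1, (map_content _ _).trans p.2.2.content_comp⟩) <| by
    refine ⟨?_, ?_⟩
    · rintro ⟨⟨w, σ⟩, hw, hσ⟩ ⟨⟨w', σ'⟩, hw', hσ'⟩ h
      obtain rfl : w = w' := eq_of_monotone_of_content_eq hw hw' (congrArg Subtype.val h)
      obtain rfl : σ = σ' := (hσ.eq_sort hs hw).trans (hσ'.eq_sort hs hw).symm
      rfl
    · rintro ⟨M, hM⟩
      obtain ⟨w, hw, rfl⟩ := exists_monotone_content_eq M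
      exact ⟨⟨(w, _), hw, isMate_sort hs hw ((map_content _ _).symm.trans hM)⟩, rfl⟩

/-- The `s`-invariant multiset generated by a multiset of representatives `b < s b` of the orbits
of `s`. -/
def orbitSum (S : Sym {b // b < s b} n) : Sym β (2 * n) :=
  ⟨S.1.map Subtype.val + (S.1.map Subtype.val).map s, by simp [two_mul]⟩

theorem map_orbitSum (hs : Involutive s) (S : Sym {b // b < s b} n) :
    (orbitSum S).map s = orbitSum S := by
  refine Subtype.ext ?_
  change (S.1.map Subtype.val + (S.1.map Subtype.val).map s).map s = _
  rw [Multiset.map_add, Multiset.map_map s s, hs.comp_self, Multiset.map_id, add_comm]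
  rfl

theorem orbitSum_injective (hs : Involutive s) :
    Injective (orbitSum : Sym {b // b < s b} n → Sym β (2 * n)) := by
  have filter_orbitSum (S : Sym {b // b < s b} n) :
      (orbitSum S).1.filter (fun b => b < s b) = S.1.map Subtype.val := by
    rw [orbitSum, Multiset.filter_add, Multiset.filter_eq_self.2, Multiset.filter_eq_nil.2,
      add_zero]
    · simp only [Multiset.mem_map]
      rintro _ ⟨_, ⟨b, -, rfl⟩, rfl⟩
      rw [hs]
      exact b.2.not_gt
    · simp only [Multiset.mem_map]
      rintro _ ⟨b, -, rfl⟩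
      exact b.2
  intro S T h
  refine Subtype.ext (Multiset.map_injective Subtype.val_injective ?_)
  rw [← filter_orbitSum, ← filter_orbitSum, h]

theorem exists_orbitSum_eq (hs : Involutive s) (hfix : ∀ b, s b ≠ b) (M : Sym β (2 * n))
    (hM : M.map s = M) : ∃ S : Sym {b // b < s b} n, orbitSum S = M := by
  have hM' : M.1.map s = M.1 := congrArg Subtype.val hM
  have map_filter : (M.1.filter fun b => b < s b).map s = M.1.filter fun b => ¬ b < s b := by
    conv_rhs => rw [← hM', Multiset.filter_map]
    refine congrArg _ (Multiset.filter_congr fun b _ => ?_)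
    rw [comp_apply, hs, not_lt]
    exact ⟨le_of_lt, fun h => h.lt_of_ne' (hfix b)⟩
  obtain ⟨S, hS⟩ : ∃ S : Multiset {b // b < s b}, S.map Subtype.val = M.1.filter fun b => b < s b :=
    CanLift.prf _ fun b hb => (Multiset.mem_filter.1 hb).2
  have orbit_sum : S.map Subtype.val + (S.map Subtype.val).map s = M.1 := by
    rw [hS, map_filter, Multiset.filter_add_not]
  have card_eq : Multiset.card S = n := by
    have := congrArg Multiset.card orbit_sum
    simp only [Multiset.card_add, Multiset.card_map, M.2] at this
    omega
  exact ⟨⟨S, card_eq⟩, Subtype.ext orbit_sum⟩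

theorem natCard_matedWord (hs : Involutive s) (hfix : ∀ b, s b ≠ b) (n : ℕ) :
    Nat.card {p : (Fin (2 * n) → β) × Equiv.Perm (Fin (2 * n)) //
      Monotone p.1 ∧ IsMate s p.1 p.2} = (Nat.card {b // b < s b}).multichoose n := by
  rw [← Sym.natCard_sym_eq_multichoose]
  exact Nat.card_congr ((matedWordEquiv _ hs).trans (Equiv.ofBijective
    (fun S => ⟨orbitSum S, map_orbitSum hs S⟩)
    ⟨fun S T h => orbitSum_injective hs (congrArg Subtype.val h), fun M =>
      let ⟨S, hS⟩ := exists_orbitSum_eq hs hfix M.1 M.2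
      ⟨S, Subtype.ext hS⟩⟩).symm)

end MatedWords

section LabelledMatchings

variable {α : Type*} {G : SimpleGraph α} {N : ℕ} {w : Fin N → G.Dart} {σ : Equiv.Perm (Fin N)}

theorem IsMate.snd_eq (h : IsMate SimpleGraph.Dart.symm w σ) (i : Fin N) :
    (w i).snd = (w (σ i)).fst :=
  congrArg (fun d : G.Dart => d.fst) (h.apply_mate i).symm

variable [LinearOrder α]

/-- The lexicographic order on the oriented edges of a graph. -/
instance : LinearOrder G.Dart :=
  LinearOrder.lift' (fun d => toLex d.toProd) fun _ _ h =>
    SimpleGraph.Dart.ext _ _ (toLex.injective h)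

theorem dart_le_iff {d e : G.Dart} : d ≤ e ↔ d.fst < e.fst ∨ d.fst = e.fst ∧ d.snd ≤ e.snd :=
  Prod.Lex.toLex_le_toLex

theorem monotone_fst : Monotone fun d : G.Dart => d.fst := fun _ _ h =>
  (dart_le_iff.1 h).elim le_of_lt fun h => h.1.le

theorem IsMate.strictMono_fst (h : IsMate SimpleGraph.Dart.symm w σ) (hw : Monotone w) :
    StrictMono fun i => toLex ((w i).fst, σ i) := by
  intro i j hij
  refine Prod.Lex.toLex_lt_toLex.2 ((monotone_fst (hw hij.le)).lt_or_eq.imp_right fun hfst =>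
    ⟨hfst, ?_⟩)
  have hsnd : (w i).snd ≤ (w j).snd :=
    ((dart_le_iff.1 (hw hij.le)).resolve_left hfst.not_lt).2
  rcases hsnd.lt_or_eq with hlt | heq
  · rw [h.snd_eq, h.snd_eq] at hlt
    exact lt_of_not_ge fun hle => hlt.not_ge (monotone_fst (hw hle))
  · exact h.lt_of_eq hij (SimpleGraph.Dart.ext _ _ (Prod.ext hfst heq))

theorem lt_symm_iff {d : G.Dart} : d < d.symm ↔ d.fst < d.snd := by
  change toLex d.toProd < toLex d.toProd.swap ↔ _
  rw [Prod.Lex.toLex_lt_toLex]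
  exact ⟨fun h => h.resolve_right fun h => d.fst_ne_snd h.1, Or.inl⟩

theorem bijective_edge_of_lt_symm :
    Bijective fun d : {d : G.Dart // d < d.symm} => (⟨d.1.edge, d.1.edge_mem⟩ : G.edgeSet) := by
  refine ⟨fun ⟨d, hd⟩ ⟨e, he⟩ h => ?_, fun ⟨e, he⟩ => ?_⟩
  · rcases (SimpleGraph.dart_edge_eq_iff d e).1 (congrArg Subtype.val h) with rfl | rfl
    · rfl
    · rw [e.symm_symm] at hd
      exact absurd hd he.not_gt
  · induction e with
    | h a b =>
      rcases lt_or_gt_of_ne (G.ne_of_adj he) with hab | hab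
      · exact ⟨⟨⟨(a, b), he⟩, lt_symm_iff.2 hab⟩, rfl⟩
      · exact ⟨⟨⟨(b, a), he.symm⟩, lt_symm_iff.2 hab⟩, Subtype.ext Sym2.eq_swap⟩

/-- A graph homomorphism from a perfect matching of the positions `0, …, N - 1` to `G` for which
the positions are sorted by their labels and positions with the same label by their mates. -/
@[ext]
structure LabelledMatching (G : SimpleGraph α) (N : ℕ) where
  mate : Equiv.Perm (Fin N)
  label : Fin N → α
  involutive : Involutive mate
  strictMono : StrictMono fun i => toLex (label i, mate i)
  adj : ∀ i, G.Adj (label i) (label (mate i))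

namespace LabelledMatching

/-- The edges covered by a labelled matching, oriented away from each of the positions. -/
def dart (x : LabelledMatching G N) (i : Fin N) : G.Dart :=
  ⟨(x.label i, x.label (x.mate i)), x.adj i⟩

theorem monotone_label (x : LabelledMatching G N) : Monotone x.label := fun _ _ hij =>
  (Prod.Lex.toLex_le_toLex.1 (x.strictMono.monotone hij)).elim le_of_lt fun h => h.1.le

theorem mate_lt_mate (x : LabelledMatching G N) {i j : Fin N} (hij : i < j)
    (h : x.label i = x.label j) : x.mate i < x.mate j :=
  ((Prod.Lex.toLex_lt_toLex.1 (x.strictMono hij)).resolve_left h.not_lt).2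

theorem monotone_dart (x : LabelledMatching G N) : Monotone x.dart := fun i j hij => by
  refine dart_le_iff.2 ((x.monotone_label hij).lt_or_eq.imp_right fun h => ⟨h, ?_⟩)
  rcases hij.eq_or_lt with rfl | hlt
  · exact le_rfl
  · exact x.monotone_label (x.mate_lt_mate hlt h).le

theorem isMate_dart (x : LabelledMatching G N) : IsMate SimpleGraph.Dart.symm x.dart x.mate where
  apply_mate i := SimpleGraph.Dart.ext _ _ (Prod.ext rfl (congrArg x.label (x.involutive i)))
  lt_of_eq _ _ hij h := x.mate_lt_mate hij (congrArg (fun d : G.Dart => d.fst) h)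

/-- A labelled matching is the same as a weakly increasing word of oriented edges with a mate for
the reversal of edges. -/
def equivMatedWord : LabelledMatching G N ≃
    {p : (Fin N → G.Dart) × Equiv.Perm (Fin N) //
      Monotone p.1 ∧ IsMate SimpleGraph.Dart.symm p.1 p.2} where
  toFun x := ⟨(x.dart, x.mate), x.monotone_dart, x.isMate_dart⟩
  invFun p :=
    { mate := p.1.2
      label i := (p.1.1 i).fst
      involutive := p.2.2.involutive SimpleGraph.Dart.symm_involutive p.2.1
      strictMono := p.2.2.strictMono_fst p.2.1
      adj i := p.2.2.snd_eq i ▸ (p.1.1 i).adj }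
  left_inv _ := rfl
  right_inv p := Subtype.ext <| Prod.ext
    (funext fun i => SimpleGraph.Dart.ext _ _ (Prod.ext rfl (p.2.2.snd_eq i).symm)) rfl

theorem natCard_eq_multichoose (G : SimpleGraph α) (n : ℕ) :
    Nat.card (LabelledMatching G (2 * n)) = (Nat.card G.edgeSet).multichoose n := by
  rw [Nat.card_congr equivMatedWord, natCard_matedWord SimpleGraph.Dart.symm_involutive
    SimpleGraph.Dart.symm_ne, Nat.card_congr (.ofBijective _ bijective_edge_of_lt_symm)]

end LabelledMatching

end LabelledMatchings

section ParityGraph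

variable {m : ℕ}

/-- The graph on the colours `0, …, 2 * m` in which distinct colours of the same parity are
joined. -/
def parityGraph (m : ℕ) : SimpleGraph (Fin (2 * m + 1)) where
  Adj a b := a ≠ b ∧ (a : ℕ) % 2 = b % 2
  symm := ⟨fun _ _ h => ⟨h.1.symm, h.2.symm⟩⟩
  loopless := ⟨fun _ h => h.1 rfl⟩

theorem mk_mem_edgeSet_parityGraph {a b : Fin (2 * m + 1)} :
    s(a, b) ∈ (parityGraph m).edgeSet ↔ (a : ℕ) ≠ b ∧ (a : ℕ) % 2 = b % 2 :=
  and_congr_left' Fin.val_ne_iff.symm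

/-- The edge of the parity graph indexed by `(i, j)`: it is even for `i ≤ j` and odd for
`j < i`. -/
def parityEdge (p : Fin m × Fin m) : (parityGraph m).edgeSet :=
  if h : p.1 ≤ p.2 then
    ⟨s(⟨2 * p.1, by omega⟩, ⟨2 * p.2 + 2, by omega⟩), mk_mem_edgeSet_parityGraph.2 (by grind)⟩
  else
    ⟨s(⟨2 * p.2 + 1, by omega⟩, ⟨2 * p.1 + 1, by omega⟩),
      mk_mem_edgeSet_parityGraph.2 (by grind)⟩

theorem parityEdge_injective : Injective (parityEdge (m := m)) := by
  rintro ⟨i, j⟩ ⟨i', j'⟩ h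
  simp only [parityEdge] at h
  rw [Prod.mk.injEq, Fin.ext_iff, Fin.ext_iff]
  split_ifs at h <;>
    simp only [Subtype.mk.injEq, Sym2.eq_iff, Fin.mk.injEq] at h <;> omega

theorem parityEdge_surjective : Surjective (parityEdge (m := m)) := by
  rintro ⟨e, he⟩
  induction e with
  | h a b =>
    wlog hab : a < b generalizing a b
    · obtain ⟨p, hp⟩ := this b a (Sym2.eq_swap ▸ he)
        (lt_of_le_of_ne (not_lt.1 hab) (Fin.val_ne_iff.1 (mk_mem_edgeSet_parityGraph.1 he).1.symm))
      exact ⟨p, hp.trans (Subtype.ext Sym2.eq_swap)⟩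
    have parity := (mk_mem_edgeSet_parityGraph.1 he).2
    rcases Nat.even_or_odd' a with ⟨i, hi | hi⟩
    · refine ⟨(⟨i, by omega⟩, ⟨(b - 2) / 2, by omega⟩), ?_⟩
      rw [parityEdge, dif_pos (Fin.mk_le_mk.2 (by omega))]
      exact Subtype.ext (congrArg₂ (s(·, ·)) (Fin.ext hi.symm) (Fin.ext (by grind)))
    · refine ⟨(⟨b / 2, by omega⟩, ⟨i, by omega⟩), ?_⟩
      rw [parityEdge, dif_neg (Fin.mk_le_mk.not.2 (by omega))]
      exact Subtype.ext (congrArg₂ (s(·, ·)) (Fin.ext hi.symm) (Fin.ext (by grind)))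

theorem natCard_edgeSet_parityGraph (m : ℕ) : Nat.card (parityGraph m).edgeSet = m ^ 2 := by
  rw [← Nat.card_congr (.ofBijective _ ⟨parityEdge_injective, parityEdge_surjective (m := m)⟩),
    Nat.card_prod, Nat.card_fin, sq]

end ParityGraph

section SignedMatchings

variable {N : ℕ}

/-- The parametrization of `Ω_N` in which `none` stands for `0` and `some (e, i)` for the signed
index `e * (i + 1)`. -/
def Omega.ofOption : Option (ℤˣ × Fin N) → Omega N
  | none => ⟨0, by omega⟩
  | some (e, i) => ⟨e * (i + 1), by
      rcases Int.units_eq_one_or e with rfl | rfl <;> grind [Units.val_one, Units.val_neg]⟩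

theorem Omega.ofOption_none_ne_some (e : ℤˣ) (i : Fin N) :
    ofOption none ≠ ofOption (some (e, i)) := fun h =>
  mul_ne_zero e.ne_zero (by omega) (congrArg Subtype.val h).symm

theorem Omega.ofOption_bijective : Bijective (ofOption (N := N)) := by
  refine ⟨?_, fun ⟨a, ha⟩ => ?_⟩
  · rintro (_ | ⟨e, i⟩) (_ | ⟨e', i'⟩) h
    · rfl
    · exact absurd h (ofOption_none_ne_some e' i')
    · exact absurd h.symm (ofOption_none_ne_some e i)
    · have hval : (e : ℤ) * (i + 1) = e' * (i' + 1) := congrArg Subtype.val h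
      rcases Int.units_eq_one_or e with rfl | rfl <;>
        rcases Int.units_eq_one_or e' with rfl | rfl <;>
        grind [Units.val_one, Units.val_neg]
  · rcases lt_trichotomy a 0 with hneg | rfl | hpos
    · refine ⟨some (-1, ⟨a.natAbs - 1, by omega⟩), Subtype.ext ?_⟩
      grind [ofOption, Units.val_one, Units.val_neg]
    · exact ⟨none, rfl⟩
    · refine ⟨some (1, ⟨a.natAbs - 1, by omega⟩), Subtype.ext ?_⟩
      grind [ofOption, Units.val_one, Units.val_neg]

theorem Omega.opp_ofOption_none : (ofOption (none : Option (ℤˣ × Fin N))).opp = ofOption none :=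
  rfl

theorem Omega.opp_ofOption_some (e : ℤˣ) (i : Fin N) :
    (ofOption (some (e, i))).opp = ofOption (some (-e, i)) :=
  Subtype.ext (by simp [ofOption, opp])

theorem Omega.ofIndex_succ (i : Fin N) : ofIndex i.succ = ofOption (some (1, i)) :=
  Subtype.ext (by simp [ofOption, ofIndex])

/-- A perfect matching of the positions `0, …, N - 1` with a sign on each of its edges. -/
@[ext]
structure SignedMatching (N : ℕ) where
  mate : Equiv.Perm (Fin N)
  sign : Fin N → ℤˣ
  involutive : Involutive mate
  mate_ne : ∀ i, mate i ≠ i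
  sign_mate : ∀ i, sign (mate i) = sign i

namespace SignedMatching

noncomputable instance : Fintype (SignedMatching N) :=
  .ofInjective (fun x => (x.mate, x.sign)) fun _ _ h =>
    SignedMatching.ext (congrArg Prod.fst h) (congrArg Prod.snd h)

/-- The involution of the signed indices that maps `i` to its mate with the sign of their edge. -/
def act (x : SignedMatching N) : Option (ℤˣ × Fin N) → Option (ℤˣ × Fin N) :=
  Option.map fun p => (p.1 * x.sign p.2, x.mate p.2)

theorem involutive_act (x : SignedMatching N) : Involutive x.act := by
  rintro (_ | ⟨e, i⟩)
  · rfl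
  · simp [act, x.sign_mate, x.involutive i, mul_assoc]

/-- The signed permutation defined by the involution of the signed indices. -/
noncomputable def toPerm (x : SignedMatching N) : Equiv.Perm (Omega N) :=
  (Equiv.ofBijective _ Omega.ofOption_bijective).permCongr x.involutive_act.toPerm

theorem toPerm_ofOption (x : SignedMatching N) (o : Option (ℤˣ × Fin N)) :
    x.toPerm (Omega.ofOption o) = Omega.ofOption (x.act o) := by
  rw [toPerm, Equiv.permCongr_apply, Equiv.ofBijective_symm_apply_apply]
  rfl

theorem toPerm_mem_hyperoctahedral (x : SignedMatching N) : x.toPerm ∈ hyperoctahedral N := by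
  intro a
  obtain ⟨_ | ⟨e, i⟩, rfl⟩ := Omega.ofOption_bijective.surjective a
  · simp [toPerm_ofOption, Omega.opp_ofOption_none, act]
  · simp [toPerm_ofOption, Omega.opp_ofOption_some, act]

/-- The signed involution defined by a signed matching. -/
noncomputable def toHyperoctahedral (x : SignedMatching N) : hyperoctahedral N :=
  ⟨x.toPerm, x.toPerm_mem_hyperoctahedral⟩

theorem letter_zero (x : SignedMatching N) : letter x.toHyperoctahedral 0 = 0 :=
  congrArg Subtype.val (x.toPerm_ofOption none)

theorem letter_succ (x : SignedMatching N) (i : Fin N) :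
    letter x.toHyperoctahedral i.succ = x.sign i * (x.mate i + 1) := by
  rw [letter, Omega.ofIndex_succ]
  refine (congrArg Subtype.val (x.toPerm_ofOption _)).trans ?_
  simp [act, Omega.ofOption]

theorem isFixedPointFreeInvolution (x : SignedMatching N) :
    IsFixedPointFreeInvolution x.toHyperoctahedral := by
  refine ⟨inv_eq_of_mul_eq_one_left (Subtype.ext (Equiv.ext fun a => ?_)), fun i hi => ?_⟩
  · obtain ⟨o, rfl⟩ := Omega.ofOption_bijective.surjective a
    change x.toPerm (x.toPerm _) = _
    rw [toPerm_ofOption, toPerm_ofOption, x.involutive_act]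
    rfl
  · obtain ⟨j, rfl⟩ := Fin.exists_succ_eq.2 (Fin.pos_iff_ne_zero.1 hi)
    have hne : (x.mate j : ℕ) ≠ j := Fin.val_ne_iff.2 (x.mate_ne j)
    rw [letter_succ, Fin.val_succ]
    rcases Int.units_eq_one_or (x.sign j) with h | h <;> rw [h] <;> push_cast <;> omega

theorem toHyperoctahedral_injective : Injective (toHyperoctahedral (N := N)) := by
  intro x y h
  have act_eq (i : Fin N) : x.act (some (1, i)) = y.act (some (1, i)) := by
    refine Omega.ofOption_bijective.injective ?_
    rw [← toPerm_ofOption, ← toPerm_ofOption]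
    exact DFunLike.congr_fun (congrArg Subtype.val h) _
  simp only [act, Option.map_some, one_mul, Option.some.injEq, Prod.mk.injEq] at act_eq
  exact SignedMatching.ext (Equiv.ext fun i => (act_eq i).2) (funext fun i => (act_eq i).1)

theorem exists_apply_ofOption (π : hyperoctahedral N) :
    ∃ (ε : Fin N → ℤˣ) (σ : Fin N → Fin N), ∀ o,
      π.1 (Omega.ofOption o) = Omega.ofOption (o.map fun p => (p.1 * ε p.2, σ p.2)) := by
  have apply_zero : π.1 (Omega.ofOption none) = Omega.ofOption none := by
    have := congrArg Subtype.val (π.2 (Omega.ofOption none))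
    rw [Omega.opp_ofOption_none] at this
    exact Subtype.ext (self_eq_neg.1 this)
  have exists_apply (i : Fin N) :
      ∃ p, π.1 (Omega.ofOption (some (1, i))) = Omega.ofOption (some p) := by
    obtain ⟨_ | p, hp⟩ := Omega.ofOption_bijective.surjective (π.1 (Omega.ofOption (some (1, i))))
    · exact absurd (π.1.injective (apply_zero.trans hp)) (Omega.ofOption_none_ne_some 1 i)
    · exact ⟨p, hp.symm⟩
  choose p hp using exists_apply
  refine ⟨fun i => (p i).1, fun i => (p i).2, ?_⟩
  rintro (_ | ⟨e, i⟩)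
  · exact apply_zero
  · rcases Int.units_eq_one_or e with rfl | rfl
    · simpa using hp i
    · rw [← Omega.opp_ofOption_some, π.2, hp, Omega.opp_ofOption_some]
      simp

theorem exists_toHyperoctahedral_eq {π : hyperoctahedral N} (hπ : IsFixedPointFreeInvolution π) :
    ∃ x : SignedMatching N, x.toHyperoctahedral = π := by
  obtain ⟨ε, σ, hεσ⟩ := exists_apply_ofOption π
  have apply_apply (a) : π.1 (π.1 a) = a := by
    nth_rewrite 1 [← hπ.1]
    exact π.1.symm_apply_apply a
  have mate_mate (i) : ε i * ε (σ i) = 1 ∧ σ (σ i) = i := by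
    have := apply_apply (Omega.ofOption (some (1, i)))
    rw [hεσ, hεσ] at this
    simpa using Omega.ofOption_bijective.injective this
  have mate_ne (i) : σ i ≠ i := fun hi => by
    have := hπ.2 i.succ (by simp)
    rw [letter, Omega.ofIndex_succ, hεσ, Option.map_some, one_mul, hi] at this
    rcases Int.units_eq_one_or (ε i) with h | h <;> simp [h, Omega.ofOption] at this
  have sign_mate (i) : ε (σ i) = ε i :=
    (eq_inv_of_mul_eq_one_right (mate_mate i).1).trans (Int.units_inv_eq_self _)
  refine ⟨⟨Involutive.toPerm σ fun i => (mate_mate i).2, ε, fun i => (mate_mate i).2, mate_ne,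
    sign_mate⟩, Subtype.ext (Equiv.ext fun a => ?_)⟩
  obtain ⟨o, rfl⟩ := Omega.ofOption_bijective.surjective a
  exact (toPerm_ofOption _ o).trans (hεσ o).symm

/-- Signed matchings are the fixed-point free signed involutions. -/
noncomputable def equivInvolution (N : ℕ) :
    SignedMatching N ≃ {π : hyperoctahedral N // IsFixedPointFreeInvolution π} :=
  .ofBijective (fun x => ⟨x.toHyperoctahedral, x.isFixedPointFreeInvolution⟩)
    ⟨fun _ _ h => toHyperoctahedral_injective (congrArg Subtype.val h), fun π =>
      let ⟨x, hx⟩ := exists_toHyperoctahedral_eq π.2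
      ⟨x, Subtype.ext hx⟩⟩

theorem J_eq_natCard (N : ℕ) (k : ℤ) :
    J N k = Nat.card {x : SignedMatching N // (rDes x.toHyperoctahedral : ℤ) = k} := by
  rw [J, ← Nat.card_coe_set_eq]
  exact Nat.card_congr (((equivInvolution N).subtypeEquiv fun _ => Iff.rfl).trans
    (Equiv.subtypeSubtypeEquivSubtypeInter _ fun π : hyperoctahedral N => (rDes π : ℤ) = k)).symm

end SignedMatching

end SignedMatchings

section Chains

variable {N m : ℕ} {a : Fin N → ℕ}

/-- The chains `0 = F 0 ≤ ⋯ ≤ F N ≤ m` of natural numbers whose `i`-th step is at least `a i`. -/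
def chains (a : Fin N → ℕ) (m : ℕ) : Set (Fin (N + 1) → ℕ) :=
  {F | F 0 = 0 ∧ (∀ i, F (Fin.castSucc i) + a i ≤ F i.succ) ∧ F (Fin.last N) ≤ m}

theorem partialSum_last (a : Fin N → ℕ) : Fin.partialSum a (Fin.last N) = ∑ i, a i := by
  rw [Fin.partialSum, Fin.val_last, List.take_of_length_le (by simp), List.sum_ofFn]

/-- The chain whose steps exceed the minimal ones `a i` by the steps of the weakly increasing word
`g`. -/
def chainOfWord (a : Fin N → ℕ) (g : Fin N → Fin (m + 1 - ∑ i, a i)) (j : Fin (N + 1)) : ℕ :=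
  Fin.cases 0 (fun i => (g i : ℕ)) j + Fin.partialSum a j

theorem chainOfWord_succ (g : Fin N → Fin (m + 1 - ∑ i, a i)) (i : Fin N) :
    chainOfWord a g i.succ = g i + Fin.partialSum a i.succ := rfl

theorem chainOfWord_mem_chains {g : Fin N → Fin (m + 1 - ∑ i, a i)} (hg : Monotone g) :
    chainOfWord a g ∈ chains a m := by
  refine ⟨by simp [chainOfWord], fun i => ?_, ?_⟩
  · rw [chainOfWord_succ, chainOfWord, Fin.partialSum_succ, add_assoc]
    gcongr
    obtain _ | N := N
    · exact i.elim0
    cases i using Fin.cases with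
    | zero => exact Nat.zero_le _
    | succ i => exact hg (Fin.castSucc_lt_succ (i := i)).le
  · obtain _ | N := N
    · simp [chainOfWord]
    · rw [← Fin.succ_last, chainOfWord_succ, Fin.succ_last, partialSum_last]
      omega

theorem chainOfWord_injective : Injective (chainOfWord (m := m) a) := fun _ _ h =>
  funext fun i => Fin.ext (add_right_cancel (congrFun h i.succ))

theorem exists_chainOfWord_eq {F : Fin (N + 1) → ℕ} (hF : F ∈ chains a m) :
    ∃ g : Fin N → Fin (m + 1 - ∑ i, a i), Monotone g ∧ chainOfWord a g = F := by
  obtain ⟨F_zero, step, F_last⟩ := hF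
  have partialSum_le (j) : Fin.partialSum a j ≤ F j := by
    induction j using Fin.induction with
    | zero => simp
    | succ i ih => rw [Fin.partialSum_succ]; linarith [step i]
  have monotone_sub : Monotone fun j => F j - Fin.partialSum a j :=
    Fin.monotone_iff_le_succ.2 fun i => by
      have := step i
      simp only [Fin.partialSum_succ]
      omega
  have sub_lt (i : Fin N) : F i.succ - Fin.partialSum a i.succ < m + 1 - ∑ i, a i := by
    have sub_le := monotone_sub (Fin.le_last i.succ)
    have sum_le := partialSum_le (Fin.last N)
    simp only [partialSum_last] at sub_le sum_le
    omega
  refine ⟨fun i => ⟨F i.succ - Fin.partialSum a i.succ, sub_lt i⟩, fun i j hij =>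
    monotone_sub (Fin.succ_le_succ_iff.2 hij), funext fun j => ?_⟩
  cases j using Fin.cases with
  | zero => simp [chainOfWord, F_zero]
  | succ i => exact Nat.sub_add_cancel (partialSum_le i.succ)

/-- The weakly increasing words of excess steps parametrize the chains. -/
noncomputable def monotoneEquivChains (a : Fin N → ℕ) (m : ℕ) :
    {g : Fin N → Fin (m + 1 - ∑ i, a i) // Monotone g} ≃ chains a m :=
  .ofBijective (fun g => ⟨chainOfWord a g.1, chainOfWord_mem_chains g.2⟩)
    ⟨fun _ _ h => Subtype.ext (chainOfWord_injective (congrArg Subtype.val h)), fun F =>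
      let ⟨g, hg, h⟩ := exists_chainOfWord_eq F.2
      ⟨⟨g, hg⟩, Subtype.ext h⟩⟩

instance (a : Fin N → ℕ) (m : ℕ) : Finite (chains a m) :=
  .of_equiv _ (monotoneEquivChains a m)

theorem natCard_chains (a : Fin N → ℕ) (m : ℕ) :
    Nat.card (chains a m) = (m + 1 - ∑ i, a i).multichoose N := by
  rw [← Nat.card_congr (monotoneEquivChains a m), Nat.card_congr (monotoneEquivSym _ N),
    Sym.natCard_sym_eq_multichoose, Nat.card_fin]

end Chains

section Colourings

variable {N m : ℕ}

/-- The colour of a letter `a` at which a chain takes the value `k`. -/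
def colour (a : ℤ) (k : ℕ) : ℤ := 2 * k - if a < 0 then 1 else 0

/-- The colour of a letter `a` at which a chain takes the value `k`, with ties broken by the
absolute value of the letter. -/
def colourKey (a : ℤ) (k : ℕ) : ℤ ×ₗ ℕ := toLex (colour a k, a.natAbs)

theorem add_le_iff_colourKey_lt {a b : ℤ} (hab : a.natAbs ≠ b.natAbs) (k l : ℕ) :
    k + (if rLT b a then 1 else 0) ≤ l ↔ colourKey a k < colourKey b l := by
  rw [colourKey, colourKey, Prod.Lex.toLex_lt_toLex, colour, colour]
  by_cases hlt : rLT b a <;> simp only [hlt, if_true, if_false] <;> rw [rLT] at hlt <;>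
    split_ifs <;> omega

/-- The indicator function of the descents of `π`. -/
def descentIndicator (π : hyperoctahedral N) (i : Fin N) : ℕ :=
  if rLT (letter π i.succ) (letter π i.castSucc) then 1 else 0

theorem sum_descentIndicator (π : hyperoctahedral N) : ∑ i, descentIndicator π i = rDes π :=
  (card_filter _ _).symm

namespace SignedMatching

theorem natAbs_letter_succ (x : SignedMatching N) (i : Fin N) :
    (letter x.toHyperoctahedral i.succ).natAbs = x.mate i + 1 := by
  rw [letter_succ, Int.natAbs_mul, Int.units_natAbs, one_mul]
  omega

theorem letter_succ_neg_iff (x : SignedMatching N) (i : Fin N) :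
    letter x.toHyperoctahedral i.succ < 0 ↔ x.sign i = -1 := by
  rw [letter_succ]
  rcases Int.units_eq_one_or (x.sign i) with h | h <;> grind [Units.val_one, Units.val_neg]

theorem colour_letter_succ (x : SignedMatching N) (i : Fin N) (k : ℕ) :
    colour (letter x.toHyperoctahedral i.succ) k = 2 * k - if x.sign i = -1 then 1 else 0 := by
  simp only [colour, letter_succ_neg_iff]

theorem natAbs_letter_injective (x : SignedMatching N) :
    Injective fun j => (letter x.toHyperoctahedral j).natAbs := by
  refine Fin.cases (Fin.cases ?_ fun i => ?_) fun i => Fin.cases ?_ fun j => ?_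
  all_goals simp [letter_zero, natAbs_letter_succ, Fin.val_inj]

theorem mem_chains_iff (x : SignedMatching N) {F : Fin (N + 1) → ℕ} :
    F ∈ chains (descentIndicator x.toHyperoctahedral) m ↔ F 0 = 0 ∧
      StrictMono (fun j => colourKey (letter x.toHyperoctahedral j) (F j)) ∧
      F (Fin.last N) ≤ m := by
  rw [Fin.strictMono_iff_lt_succ]
  refine and_congr_right' (and_congr_left' (forall_congr' fun i => ?_))
  exact add_le_iff_colourKey_lt
    (x.natAbs_letter_injective.ne (Fin.castSucc_lt_succ (i := i)).ne) _ _

theorem colour_letter_mem_Icc (x : SignedMatching N) {F : Fin (N + 1) → ℕ}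
    (hF : F ∈ chains (descentIndicator x.toHyperoctahedral) m) (i : Fin N) :
    colour (letter x.toHyperoctahedral i.succ) (F i.succ) ∈ Set.Icc 0 (2 * m : ℤ) := by
  obtain ⟨F_zero, hlt, F_last⟩ := x.mem_chains_iff.1 hF
  have key_zero_lt := hlt (Fin.succ_pos i)
  have le_m : F i.succ ≤ m := by
    refine le_trans (Fin.monotone_iff_le_succ.2 (fun i => ?_) (Fin.le_last i.succ)) F_last
    exact (Nat.le_add_right _ _).trans (hF.2.1 i)
  simp only [F_zero, letter_zero, colourKey, Prod.Lex.toLex_lt_toLex] at key_zero_lt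
  constructor
  · exact key_zero_lt.elim le_of_lt fun h => h.1.le
  · rw [colour]
    split_ifs <;> omega

/-- The colours of the letters of a signed matching along a chain. -/
noncomputable def label (x : SignedMatching N)
    (F : chains (descentIndicator x.toHyperoctahedral) m) (i : Fin N) : Fin (2 * m + 1) :=
  ⟨(colour (letter x.toHyperoctahedral i.succ) (F.1 i.succ)).toNat, by
    have := (x.colour_letter_mem_Icc F.2 i).2
    omega⟩

section Label

variable (x : SignedMatching N) (F : chains (descentIndicator x.toHyperoctahedral) m)

theorem coe_label (i : Fin N) :
    (x.label F i : ℤ) = colour (letter x.toHyperoctahedral i.succ) (F.1 i.succ) :=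
  Int.toNat_of_nonneg (x.colour_letter_mem_Icc F.2 i).1

theorem coe_label_add (i : Fin N) :
    (x.label F i : ℕ) + (if x.sign i = -1 then 1 else 0) = 2 * F.1 i.succ := by
  have := x.coe_label F i
  rw [colour_letter_succ] at this
  split_ifs at this ⊢ <;> omega

theorem strictMono_label_mate : StrictMono fun i => toLex (x.label F i, x.mate i) := by
  intro i j hij
  have key_lt := (x.mem_chains_iff.1 F.2).2.1 (Fin.succ_lt_succ_iff.2 hij)
  simp only [colourKey, ← coe_label, natAbs_letter_succ, Prod.Lex.toLex_lt_toLex] at key_lt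
  simp only [Prod.Lex.toLex_lt_toLex, Fin.lt_def, Fin.ext_iff]
  omega

theorem adj_label (i : Fin N) : (parityGraph m).Adj (x.label F i) (x.label F (x.mate i)) := by
  refine ⟨fun heq => ?_, ?_⟩
  · have lt_iff_lt : i < x.mate i ↔ x.mate i < i := by
      rw [← (x.strictMono_label_mate F).lt_iff_lt, Prod.Lex.toLex_lt_toLex]
      simp only [← heq, x.involutive i, lt_irrefl, true_and, false_or]
    rcases (x.mate_ne i).lt_or_gt with hlt | hgt
    · exact hlt.not_gt (lt_iff_lt.2 hlt)
    · exact hgt.not_gt (lt_iff_lt.1 hgt)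
  · have := x.coe_label_add F i
    have := x.coe_label_add F (x.mate i)
    rw [x.sign_mate] at this
    omega

/-- The labelling of a signed matching by the colours of its letters along a chain. -/
noncomputable def toLabelledMatching : LabelledMatching (parityGraph m) N where
  mate := x.mate
  label := x.label F
  involutive := x.involutive
  strictMono := x.strictMono_label_mate F
  adj := x.adj_label F

end Label

theorem toLabelledMatching_injective :
    Injective fun p : Σ x : SignedMatching N, chains (descentIndicator x.toHyperoctahedral) m =>
      p.1.toLabelledMatching p.2 := by
  rintro ⟨x, F⟩ ⟨x', F'⟩ h
  have mate_eq : x.mate = x'.mate := congrArg LabelledMatching.mate h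
  have label_eq (i) : x.label F i = x'.label F' i := congrFun (congrArg LabelledMatching.label h) i
  have sign_eq_and_chain_eq (i) : x.sign i = x'.sign i ∧ F.1 i.succ = F'.1 i.succ := by
    have h := x.coe_label_add F i
    have h' := x'.coe_label_add F' i
    rw [label_eq] at h
    rcases Int.units_eq_one_or (x.sign i) with hs | hs <;>
      rcases Int.units_eq_one_or (x'.sign i) with hs' | hs' <;>
      grind
  obtain rfl : x = x' := SignedMatching.ext mate_eq (funext fun i => (sign_eq_and_chain_eq i).1)
  obtain rfl : F = F' := Subtype.ext <| funext <| Fin.cases (F.2.1.trans F'.2.1.symm) fun i =>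
    (sign_eq_and_chain_eq i).2
  rfl

end SignedMatching

namespace LabelledMatching

variable (y : LabelledMatching (parityGraph m) N)

/-- The signed matching underlying a labelled matching: odd labels are negative signs. -/
def toSignedMatching : SignedMatching N where
  mate := y.mate
  sign i := (-1) ^ (y.label i : ℕ)
  involutive := y.involutive
  mate_ne i h := (y.adj i).1 (congrArg y.label h.symm)
  sign_mate i := neg_one_pow_congr (by rw [Nat.even_iff, Nat.even_iff, (y.adj i).2])

/-- The chain along which the letters of the underlying signed matching have the given labels as
their colours. -/
def toChain : Fin (N + 1) → ℕ :=
  Fin.cases 0 fun i => (y.label i + 1) / 2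

theorem colour_toChain (i : Fin N) :
    colour (letter y.toSignedMatching.toHyperoctahedral i.succ) (y.toChain i.succ) =
      y.label i := by
  rw [SignedMatching.colour_letter_succ, toChain, Fin.cases_succ]
  change _ - (if (-1 : ℤˣ) ^ (y.label i : ℕ) = -1 then 1 else 0) = _
  rcases Nat.even_or_odd (y.label i : ℕ) with even | odd
  · rw [even.neg_one_pow, if_neg (by decide)]
    grind
  · rw [odd.neg_one_pow, if_pos rfl]
    grind

theorem toChain_mem_chains :
    y.toChain ∈ chains (descentIndicator y.toSignedMatching.toHyperoctahedral) m := by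
  refine y.toSignedMatching.mem_chains_iff.2 ⟨rfl, fun i j hij => ?_, ?_⟩
  · cases j using Fin.cases with
    | zero => exact absurd hij (Fin.not_lt_zero i)
    | succ j =>
      simp only [colourKey, Prod.Lex.toLex_lt_toLex, colour_toChain,
        SignedMatching.natAbs_letter_succ]
      cases i using Fin.cases with
      | zero =>
        rw [SignedMatching.letter_zero]
        change (0 : ℤ) < y.label j ∨ (0 : ℤ) = y.label j ∧ 0 < (y.mate j : ℕ) + 1
        omega
      | succ i =>
        have lt := Prod.Lex.toLex_lt_toLex.1 (y.strictMono (Fin.succ_lt_succ_iff.1 hij))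
        simp only [colour_toChain, SignedMatching.natAbs_letter_succ]
        simp only [Fin.lt_def, Fin.ext_iff] at lt
        change _ ∨ _ ∧ (y.mate i : ℕ) + 1 < y.mate j + 1
        omega
  · obtain _ | N := N
    · exact Nat.zero_le m
    · rw [← Fin.succ_last, toChain, Fin.cases_succ]
      omega

theorem exists_toLabelledMatching_eq :
    ∃ p : Σ x : SignedMatching N, chains (descentIndicator x.toHyperoctahedral) m,
      p.1.toLabelledMatching p.2 = y := by
  refine ⟨⟨y.toSignedMatching, y.toChain, y.toChain_mem_chains⟩, LabelledMatching.ext rfl ?_⟩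
  exact funext fun i => Fin.ext (Int.ofNat_inj.1 ((SignedMatching.coe_label _ _ i).trans
    (y.colour_toChain i)))

end LabelledMatching

theorem natCard_labelledMatching (m N : ℕ) :
    Nat.card (LabelledMatching (parityGraph m) N) =
      ∑ x : SignedMatching N, (m + 1 - rDes x.toHyperoctahedral).multichoose N := by
  rw [← Nat.card_congr (.ofBijective _ ⟨SignedMatching.toLabelledMatching_injective (N := N)
    (m := m), LabelledMatching.exists_toLabelledMatching_eq⟩), Nat.card_sigma]
  simp only [natCard_chains, sum_descentIndicator]

end Colourings

section EulerOperator

open PowerSeries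

variable {R : Type*} [CommRing R]

/-- The Euler operator `X * d / dX` on formal power series. -/
noncomputable def eulerOperator : Derivation R R⟦X⟧ R⟦X⟧ := (X : R⟦X⟧) • derivative R

theorem coeff_eulerOperator (f : R⟦X⟧) (k : ℕ) :
    coeff k (eulerOperator f) = k * coeff k f := by
  rw [eulerOperator, Derivation.smul_apply, smul_eq_mul]
  cases k with
  | zero => simp
  | succ k => rw [coeff_succ_X_mul, coeff_derivative, mul_comm, Nat.cast_succ]

theorem eulerOperator_X : eulerOperator (X : R⟦X⟧) = X := by
  rw [eulerOperator, Derivation.smul_apply, derivative_X, smul_eq_mul, mul_one]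

/-- The numerator over `(1 - X) ^ (d + 1)` of the image under the Euler operator of the quotient
`f / (1 - X) ^ d`. -/
noncomputable def eulerNumerator (d : ℕ) (f : R⟦X⟧) : R⟦X⟧ :=
  (1 - X) * eulerOperator f + d • (X * f)

theorem eulerOperator_mul_one_sub_X_pow (f : R⟦X⟧) (d : ℕ) :
    eulerOperator f * (1 - X) ^ (d + 1) = eulerNumerator d (f * (1 - X) ^ d) := by
  cases d with
  | zero => simp [eulerNumerator, mul_comm]
  | succ d =>
    rw [eulerNumerator, Derivation.leibniz, Derivation.leibniz_pow, map_sub,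
      Derivation.map_one_eq_zero, eulerOperator_X, Nat.add_sub_cancel]
    simp only [smul_eq_mul, nsmul_eq_mul]
    ring

/-- The coefficient of `X ^ k` for an integer exponent `k`, which vanishes for `k < 0`. -/
noncomputable def intCoeff : ℤ → R⟦X⟧ →ₗ[R] R
  | .ofNat k => coeff k
  | .negSucc _ => 0

theorem intCoeff_X_mul (k : ℤ) (f : R⟦X⟧) : intCoeff k (X * f) = intCoeff (k - 1) f := by
  rcases k with (_ | k) | k
  · exact coeff_zero_X_mul f
  · rw [show (Int.ofNat (k + 1) - 1) = Int.ofNat k by simp]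
    exact coeff_succ_X_mul k f
  · rfl

theorem intCoeff_X_pow (k : ℤ) (n : ℕ) :
    intCoeff k (X ^ n : R⟦X⟧) = if (n : ℤ) = k then 1 else 0 := by
  rcases k with k | k
  · simp [intCoeff, coeff_X_pow, eq_comm]
  · rfl

theorem intCoeff_eulerOperator (k : ℤ) (f : R⟦X⟧) :
    intCoeff k (eulerOperator f) = k * intCoeff k f := by
  rcases k with k | k
  · exact (coeff_eulerOperator f k).trans (by simp [intCoeff])
  · exact (mul_zero _).symm

theorem intCoeff_eulerNumerator (k : ℤ) (d : ℕ) (f : R⟦X⟧) :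
    intCoeff k (eulerNumerator d f) =
      k * intCoeff k f + (d + 1 - k) * intCoeff (k - 1) f := by
  simp only [eulerNumerator, sub_mul, one_mul, map_add, map_sub, map_nsmul, intCoeff_X_mul,
    intCoeff_eulerOperator]
  rw [nsmul_eq_mul]
  push_cast
  ring

end EulerOperator

section DescentSeries

open PowerSeries

theorem succ_mul_multichoose_succ (q n : ℕ) :
    (n + 1) * q.multichoose (n + 1) = (q + n) * q.multichoose n := by
  obtain _ | q := q
  · cases n <;> simp
  · rw [Nat.multichoose_eq, Nat.multichoose_eq, add_right_comm q 1 n, ← add_assoc,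
      add_right_comm q 1 n, Nat.add_sub_cancel, Nat.add_sub_cancel, Nat.add_one_mul_choose_eq,
      mul_comm]

/-- The generating series of the numbers of multisets of `n` edges of the graphs
`parityGraph m`. -/
noncomputable def multichooseSeries (n : ℕ) : ℤ⟦X⟧ := .mk fun m => (m ^ 2).multichoose n

theorem succ_nsmul_multichooseSeries_succ (n : ℕ) :
    (n + 1) • multichooseSeries (n + 1) =
      eulerOperator (eulerOperator (multichooseSeries n)) + n • multichooseSeries n := by
  ext m
  have h : ((n : ℤ) + 1) * (m ^ 2).multichoose (n + 1) = (m ^ 2 + n) * (m ^ 2).multichoose n :=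
    mod_cast succ_mul_multichoose_succ (m ^ 2) n
  simp only [map_add, map_nsmul, coeff_eulerOperator, multichooseSeries, coeff_mk]
  simp only [nsmul_eq_mul]
  push_cast
  linear_combination h

/-- The generating polynomial of the descents of the signed matchings, as a power series. -/
noncomputable def descentSeries (N : ℕ) : ℤ⟦X⟧ :=
  ∑ x : SignedMatching N, X ^ rDes x.toHyperoctahedral

theorem intCoeff_descentSeries (N : ℕ) (k : ℤ) : intCoeff k (descentSeries N) = J N k := by
  simp_rw [SignedMatching.J_eq_natCard, Nat.card_eq_fintype_card, Fintype.card_subtype,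
    descentSeries, map_sum, intCoeff_X_pow, sum_boole]

theorem rDes_le {N : ℕ} (π : hyperoctahedral N) : rDes π ≤ N :=
  (card_le_univ _).trans_eq (Fintype.card_fin N)

theorem X_pow_mul_mk_choose {N d : ℕ} (hd : d ≤ N) :
    (X ^ d * .mk fun m => ((N + m).choose N : ℤ) : ℤ⟦X⟧) =
      .mk fun m => ((m + 1 - d).multichoose N : ℤ) := by
  ext m
  rw [coeff_X_pow_mul', coeff_mk, coeff_mk, Nat.multichoose_eq]
  split_ifs with h
  · congr 3
    omega
  · rw [Nat.choose_eq_zero_of_lt (by omega), Nat.cast_zero]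

theorem descentSeries_eq (n : ℕ) :
    descentSeries (2 * n) = multichooseSeries n * (1 - X) ^ (2 * n + 1) := by
  have mul_mk : descentSeries (2 * n) * .mk (fun m => ((2 * n + m).choose (2 * n) : ℤ)) =
      multichooseSeries n := by
    ext m
    rw [descentSeries, sum_mul, map_sum, multichooseSeries, coeff_mk,
      ← natCard_edgeSet_parityGraph, ← LabelledMatching.natCard_eq_multichoose,
      natCard_labelledMatching, Nat.cast_sum]
    exact sum_congr rfl fun x _ => by rw [X_pow_mul_mk_choose (rDes_le _), coeff_mk]
  rw [← mul_mk, mul_assoc, mk_add_choose_mul_one_sub_pow_eq_one, mul_one]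

theorem succ_nsmul_descentSeries (n : ℕ) :
    (n + 1) • descentSeries (2 * (n + 1)) =
      eulerNumerator (2 * n + 2) (eulerNumerator (2 * n + 1) (descentSeries (2 * n))) +
        n • ((1 - X) * ((1 - X) * descentSeries (2 * n))) := by
  rw [descentSeries_eq, ← smul_mul_assoc, succ_nsmul_multichooseSeries_succ, descentSeries_eq,
    ← eulerOperator_mul_one_sub_X_pow, ← eulerOperator_mul_one_sub_X_pow]
  simp only [nsmul_eq_mul]
  ring

theorem J_recurrence (n : ℕ) (k : ℤ) :
    ((n : ℤ) + 1) * J (2 * (n + 1)) k =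
      (k ^ 2 + n) * J (2 * n) k + (2 * (k - 1) * (2 * (n + 1) - k) + 1) * J (2 * n) (k - 1) +
        ((k - 2) * (k - 4 * (n + 1)) + 4 * (n + 1) ^ 2 - 3 * (n + 1)) * J (2 * n) (k - 2) := by
  have h := congrArg (intCoeff k) (succ_nsmul_descentSeries n)
  simp only [sub_mul, one_mul, map_add, map_sub, map_nsmul, intCoeff_X_mul,
    intCoeff_eulerNumerator, intCoeff_descentSeries, sub_sub, one_add_one_eq_two] at h
  simp only [nsmul_eq_mul] at h
  push_cast at h
  linear_combination h

theorem J_eq_zero_of_neg (N : ℕ) {k : ℤ} (hk : k < 0) : J N k = 0 := by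
  obtain ⟨k, rfl⟩ := Int.eq_negSucc_of_lt_zero hk
  exact Int.ofNat_inj.1 (intCoeff_descentSeries N _).symm

theorem descentSeries_zero : descentSeries 0 = 1 := by
  have multichooseSeries_zero : multichooseSeries 0 = .mk 1 := by
    ext m
    simp [multichooseSeries]
  rw [← mul_zero 2, descentSeries_eq, multichooseSeries_zero, mul_zero, zero_add, pow_one,
    mk_one_mul_one_sub_eq_one]

theorem J_zero (k : ℤ) : (J 0 k : ℤ) = if k = 0 then 1 else 0 := by
  rw [← intCoeff_descentSeries, descentSeries_zero, ← pow_zero X, intCoeff_X_pow]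
  simp only [Nat.cast_zero, eq_comm]

end DescentSeries

end SignedInvolution

theorem mainTheorem7 :
    (∀ (n : ℕ) (k : ℤ), 2 ≤ n → 0 ≤ k →
      (n : ℤ) * (SignedInvolution.J (2 * n) k : ℤ) =
        (k ^ 2 + (n : ℤ) - 1) * (SignedInvolution.J (2 * n - 2) k : ℤ) +
        (2 * (k - 1) * (2 * (n : ℤ) - k) + 1) * (SignedInvolution.J (2 * n - 2) (k - 1) : ℤ) +
        ((k - 2) * (k - 4 * (n : ℤ)) + 4 * (n : ℤ) ^ 2 - 3 * (n : ℤ)) *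
          (SignedInvolution.J (2 * n - 2) (k - 2) : ℤ)) ∧
    SignedInvolution.J 2 0 = 0 ∧ SignedInvolution.J 2 1 = 1 ∧ SignedInvolution.J 2 2 = 1 ∧
    (∀ (n : ℕ) (k : ℤ), 1 ≤ n → k < 0 → SignedInvolution.J (2 * n) k = 0) := by
  have J_two (k : ℤ) := SignedInvolution.J_recurrence 0 k
  simp only [mul_zero, SignedInvolution.J_zero] at J_two
  refine ⟨fun n k hn _ => ?_, ?_, ?_, ?_, fun n k _ hk =>
    SignedInvolution.J_eq_zero_of_neg (2 * n) hk⟩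
  · obtain ⟨n, rfl⟩ := Nat.exists_eq_add_of_le' (Nat.one_le_of_lt hn)
    have h := SignedInvolution.J_recurrence n k
    rw [show 2 * (n + 1) - 2 = 2 * n from rfl]
    push_cast
    linear_combination h
  · simpa using J_two 0
  · simpa using J_two 1
  · simpa using J_two 2
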